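/- A strict partition is a finite sequence $\lambda=(\lambda_1>\lambda_2>\dots>\lambda_l>0)$ of positive integers; put $\ell(\lambda)=l$, $|\lambda|=\lambda_1+\dots+\lambda_l$ and $\lambda_i=0$ for $i>l$. Its shifted diagram is $D'_\lambda=\{(i,j)\in\mathbb Z^2: 1\le i\le l,\ i\le j\le i+\lambda_i-1\}$, where $i$ is the row and $j$ the column. For strict partitions $\mu,\lambda$ write $\mu\subset\lambda$ if $\mu_i\le\lambda_i$ for all $i\ge 1$. If $\mu\subset\lambda$, let $g_{\lambda/\mu}$ be the number of shifted standard tableaux of shape $\lambda/\mu$, that is, of bijective labellings of $D'_\lambda\setminus D'_\mu$ by $1,2,\dots,|\lambda|-|\mu|$ that strictly increase from left to right along each row and down each column; if $\mu\not\subset\lambda$, let $g_{\lambda/\mu}=0$. Put $g_\lambda=g_{\lambda/\varnothing}$. Let $(x\downharpoonright r)=x(x-1)\cdots(x-r+1)$, with $(x\downharpoonright 0)=1$. For a strict partition $\mu$ with $\ell(\mu)\le n$, let $P^*_{\mu|n}\in\mathbb Q[x_1,\dots,x_n]$ be the polynomial $$P^*_{\mu|n}(x_1,\dots,x_n)=\frac1{(n-\ell(\mu))!}\sum_{\omega\in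 S(n)}\ \prod_{i=1}^{\ell(\mu)}\bigl(x_{\omega(i)}\downharpoonright\mu_i\bigr)\prod_{\substack{i\le \ell(\mu)\\ i<j\le n}}\frac{x_{\omega(i)}+x_{\omega(j)}}{x_{\omega(i)}-x_{\omega(j)}}$$ (the sum, a priori a rational function, is a polynomial), and let $P^*_{\mu|n}=0$ if $\ell(\mu)>n$. Write $P^*_\mu(\lambda)=P^*_{\mu|\ell(\lambda)}(\lambda_1,\dots,\lambda_{\ell(\lambda)})$. Theorem. Let $\mu,\lambda$ be strict partitions, $m=|\mu|$, $k=|\lambda|$, and $m\le k$. Then $$g_{\lambda/\mu}=g_\lambda\cdot\frac{P^*_\mu(\lambda)}{(k\downharpoonright m)}.$$ -/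

import Mathlib

namespace ShiftedDim

/-- The `i`-th part (counting from `i = 0`) of a partition, the parts being listed in weakly
decreasing order and followed by zeros. -/
noncomputable def part {k : ℕ} (lam : k.Partition) (i : ℕ) : ℕ :=
  (lam.parts.sort (· ≥ ·)).getD i 0

/-- The length of a partition: the number of its nonzero parts. -/
def length {k : ℕ} (lam : k.Partition) : ℕ := Multiset.card lam.parts

/-- Containment of diagrams: `mu i ≤ lam i` for every `i`. -/
def Contained {m k : ℕ} (mu : m.Partition) (lam : k.Partition) : Prop :=
  ∀ i, part mu i ≤ part lam i

/-- The shifted diagram, with rows and columns counted from `0`: row `i` consists of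
`part lam i` cells and is shifted `i` cells to the right. A cell is a pair (row, column). -/
def shiftedDiagram {k : ℕ} (lam : k.Partition) : Set (ℕ × ℕ) :=
  {c | c.1 ≤ c.2 ∧ c.2 < c.1 + part lam c.1}

/-- The skew shifted diagram of shape `lam / mu`. -/
def skewShiftedDiagram {m k : ℕ} (mu : m.Partition) (lam : k.Partition) : Set (ℕ × ℕ) :=
  shiftedDiagram lam \ shiftedDiagram mu

/-- Shifted standard tableaux of shape `lam / mu`: labellings of the cells of the skew shifted
diagram with the numbers `1, 2, …, |lam| - |mu|`, each used exactly once, that strictly increase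
from left to right along each row and down each column. -/
def ShiftedStandardTableau {m k : ℕ} (mu : m.Partition) (lam : k.Partition) : Type :=
  {T : skewShiftedDiagram mu lam ≃ Set.Icc 1 (k - m) //
    (∀ c d : skewShiftedDiagram mu lam,
      c.1.1 = d.1.1 → c.1.2 < d.1.2 → (T c : ℕ) < (T d : ℕ)) ∧
    (∀ c d : skewShiftedDiagram mu lam,
      c.1.2 = d.1.2 → c.1.1 < d.1.1 → (T c : ℕ) < (T d : ℕ))}

open Classical in
/-- The dimension of `lam / mu`: the number of shifted standard tableaux of shape `lam / mu`,
and `0` if `lam` does not contain `mu`. -/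
noncomputable def skewDim {m k : ℕ} (mu : m.Partition) (lam : k.Partition) : ℕ :=
  if Contained mu lam then Nat.card (ShiftedStandardTableau mu lam) else 0

/-- The dimension of `lam`, i.e. of `lam / ∅`, where `∅` is the partition of `0`. -/
noncomputable def dim {k : ℕ} (lam : k.Partition) : ℕ :=
  skewDim (default : Nat.Partition 0) lam

/-- The decreasing factorial power `x (x - 1) ⋯ (x - k + 1)`. -/
noncomputable def decFactorial {R : Type*} [CommRing R] (x : R) (k : ℕ) : R :=
  (descPochhammer R k).eval x

/-- The rational function
`∏_{i ≤ l} (x_i ↓ mu_i) * ∏_{i ≤ l, i < j ≤ n} (x_i + x_j) / (x_i - x_j)`, `l` being the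
length of `mu`, at a point `x` with coordinates in a field (indices counted from `0`). -/
noncomputable def factorialTerm {m : ℕ} (mu : m.Partition) {n : ℕ} {K : Type*} [Field K]
    (x : Fin n → K) : K :=
  (∏ i : Fin n with i.val < length mu, decFactorial (x i) (part mu i)) *
    ∏ p : Fin n × Fin n with p.1.val < length mu ∧ p.1 < p.2,
      (x p.1 + x p.2) / (x p.1 - x p.2)

/-- The sum `1 / (n - l)! * ∑_ω F(x_{ω 1}, …, x_{ω n})` over all permutations `ω`, as an element
of the field of rational functions in `x_1, …, x_n`. -/
noncomputable def symmetrization {m : ℕ} (mu : m.Partition) (n : ℕ) :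
    FractionRing (MvPolynomial (Fin n) ℚ) :=
  (1 / ((n - length mu).factorial : FractionRing (MvPolynomial (Fin n) ℚ))) *
    ∑ ω : Equiv.Perm (Fin n), factorialTerm mu fun i =>
      algebraMap (MvPolynomial (Fin n) ℚ) (FractionRing (MvPolynomial (Fin n) ℚ))
        (MvPolynomial.X (ω i))

section Existence

open MvPolynomial

theorem map_decFactorial {R S : Type*} [CommRing R] [CommRing S] (f : R →+* S) (x : R) (k : ℕ) :
    f (decFactorial x k) = decFactorial (f x) k := by
  unfold decFactorial
  rw [← descPochhammer_map f, Polynomial.eval_map, Polynomial.eval₂_hom]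

theorem vand_eq {R : Type*} [CommRing R] {n : ℕ} (x : Fin n → R) :
    (Matrix.vandermonde x).det = ∏ p : Fin n × Fin n with p.1 < p.2, (x p.2 - x p.1) := by
  rw [Matrix.det_vandermonde]
  exact (Finset.prod_finset_product (Finset.univ.filter fun p : Fin n × Fin n => p.1 < p.2)
    (Finset.univ : Finset (Fin n)) (fun i => Finset.Ioi i) (fun p => by simp)
    (f := fun p => x p.2 - x p.1)).symm

theorem vand_perm {R : Type*} [CommRing R] {n : ℕ} (x : Fin n → R) (ω : Equiv.Perm (Fin n)) :
    (Matrix.vandermonde fun i => x (ω i)).det =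
      ((Equiv.Perm.sign ω : ℤ) : R) * (Matrix.vandermonde x).det := by
  rw [← Matrix.det_permute]
  rfl

/-- The polynomial obtained from the rational function by multiplying by the Vandermonde product. -/
noncomputable def clearedTerm {m : ℕ} (mu : m.Partition) {n : ℕ} {R : Type*} [CommRing R]
    (x : Fin n → R) : R :=
  (∏ i : Fin n with i.val < length mu, decFactorial (x i) (part mu i)) *
    ∏ p : Fin n × Fin n with p.1 < p.2,
      if p.1.val < length mu then -(x p.1 + x p.2) else x p.2 - x p.1

theorem map_clearedTerm {m : ℕ} (mu : m.Partition) {n : ℕ} {R S : Type*} [CommRing R] [CommRing S]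
    (f : R →+* S) (x : Fin n → R) :
    f (clearedTerm mu x) = clearedTerm mu fun i => f (x i) := by
  unfold clearedTerm
  simp only [map_mul, map_prod, map_decFactorial, apply_ite f, map_neg, map_add, map_sub]

theorem factorialTerm_mul_vand {m : ℕ} (mu : m.Partition) {n : ℕ} {K : Type*} [Field K]
    (x : Fin n → K) (hx : Function.Injective x) :
    factorialTerm mu x * (Matrix.vandermonde x).det = clearedTerm mu x := by
  rw [vand_eq, factorialTerm, clearedTerm, mul_assoc]
  congr 1
  have h : (Finset.univ.filter fun p : Fin n × Fin n => p.1.val < length mu ∧ p.1 < p.2) =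
      (Finset.univ.filter fun p : Fin n × Fin n => p.1 < p.2).filter
        fun p => p.1.val < length mu := by
    ext p
    simp [and_comm]
  rw [h, Finset.prod_filter _ (fun p : Fin n × Fin n => (x p.1 + x p.2) / (x p.1 - x p.2)),
    ← Finset.prod_mul_distrib]
  refine Finset.prod_congr rfl fun p hp => ?_
  have hne : x p.1 - x p.2 ≠ 0 := by
    rw [sub_ne_zero]
    exact fun e => (ne_of_lt (Finset.mem_filter.1 hp).2) (hx e)
  split_ifs
  · field_simp
    ring
  · simp

/-- Identification of the variable `X j` with `X i`. -/
noncomputable def identify {n : ℕ} (i j : Fin n) :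
    MvPolynomial (Fin n) ℚ →ₐ[ℚ] MvPolynomial (Fin n) ℚ :=
  aeval fun a => if a = j then X i else X a

theorem dvd_iff_identify {n : ℕ} (i j : Fin n) (p : MvPolynomial (Fin n) ℚ) :
    X j - X i ∣ p ↔ identify i j p = 0 := by
  constructor
  · rintro ⟨q, rfl⟩
    have : identify i j (X j - X i : MvPolynomial (Fin n) ℚ) = 0 := by
      simp [identify]
    rw [map_mul, this, zero_mul]
  · intro h
    let I := Ideal.span {(X j - X i : MvPolynomial (Fin n) ℚ)}
    have hom : (Ideal.Quotient.mkₐ ℚ I).comp (identify i j) = Ideal.Quotient.mkₐ ℚ I := by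
      apply MvPolynomial.algHom_ext
      intro a
      simp only [identify, AlgHom.comp_apply, aeval_X]
      split_ifs with ha
      · subst ha
        refine (Ideal.Quotient.eq.2 ?_).symm
        exact Ideal.mem_span_singleton_self _
      · rfl
    have := DFunLike.congr_fun hom p
    rw [AlgHom.comp_apply, h, map_zero] at this
    exact Ideal.mem_span_singleton.1 (Ideal.Quotient.eq_zero_iff_mem.1 this.symm)

theorem prime_sub {n : ℕ} {i j : Fin n} (h : i ≠ j) :
    Prime (X j - X i : MvPolynomial (Fin n) ℚ) := by
  refine ⟨?_, ?_, ?_⟩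
  · rw [sub_ne_zero]
    exact fun e => h (X_injective e).symm
  · intro hu
    have := (dvd_iff_identify i j 1).1 hu.dvd
    simp at this
  · intro a b
    simp only [dvd_iff_identify, map_mul, mul_eq_zero, imp_self]

theorem vand_dvd {n : ℕ} (p : MvPolynomial (Fin n) ℚ)
    (hp : ∀ i j : Fin n, i ≠ j → rename (Equiv.swap i j) p = -p) :
    (Matrix.vandermonde (X : Fin n → MvPolynomial (Fin n) ℚ)).det ∣ p := by
  rw [vand_eq]
  apply Finset.prod_dvd_of_isRelPrime
  · rintro ⟨a, b⟩ hab ⟨c, d⟩ hcd hne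
    have hab' : a < b := by simpa using hab
    have hcd' : c < d := by simpa using hcd
    refine ((prime_sub hab'.ne).irreducible.isRelPrime_iff_not_dvd).2 ?_
    rw [dvd_iff_identify]
    simp only [identify, map_sub, aeval_X, sub_eq_zero]
    intro e
    have hcd'' := hcd'.ne
    split_ifs at e with h1 h2 h2
    · exact hcd'.ne (h2.trans h1.symm)
    · have e1 := X_injective e
      subst h1 e1
      exact hne rfl
    · have e1 := X_injective e
      subst h2 e1
      exact absurd hab' (not_lt.2 hcd'.le)
    · exact hcd'.ne (X_injective e).symm
  · rintro ⟨a, b⟩ hab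
    have hab' : a < b := by simpa using hab
    rw [dvd_iff_identify]
    have hom : (identify a b).comp (rename (Equiv.swap a b)) = identify a b := by
      apply MvPolynomial.algHom_ext
      intro c
      simp only [identify, AlgHom.comp_apply, aeval_X, rename_X]
      rcases eq_or_ne c a with rfl | hca
      · simp
      rcases eq_or_ne c b with rfl | hcb
      · simp
      rw [Equiv.swap_apply_of_ne_of_ne hca hcb]
    have e := DFunLike.congr_fun hom p
    rw [AlgHom.comp_apply, hp a b hab'.ne, map_neg] at e
    exact self_eq_neg.1 e.symm

/-- The symmetrization is a polynomial. -/
theorem exists_polynomial {m : ℕ} (mu : m.Partition) (n : ℕ) :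
    ∃ p : MvPolynomial (Fin n) ℚ,
      algebraMap (MvPolynomial (Fin n) ℚ) (FractionRing (MvPolynomial (Fin n) ℚ)) p =
        symmetrization mu n := by
  set φ := algebraMap (MvPolynomial (Fin n) ℚ) (FractionRing (MvPolynomial (Fin n) ℚ)) with hφ
  have hinj : Function.Injective φ := IsFractionRing.injective _ _
  let u : MvPolynomial (Fin n) ℚ := ∑ ω : Equiv.Perm (Fin n),
    ((Equiv.Perm.sign ω : ℤ) : MvPolynomial (Fin n) ℚ) * clearedTerm mu fun i => X (ω i)
  have hu : ∀ i j : Fin n, i ≠ j → rename (Equiv.swap i j) u = -u := by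
    intro i j hij
    simp only [u, map_sum, map_mul, map_intCast, ← Finset.sum_neg_distrib]
    refine Fintype.sum_equiv (Equiv.mulLeft (Equiv.swap i j)) _ _ fun ω => ?_
    have h := map_clearedTerm mu
      (rename (Equiv.swap i j) : MvPolynomial (Fin n) ℚ →ₐ[ℚ] _).toRingHom fun a => X (ω a)
    simp only [AlgHom.toRingHom_eq_coe, RingHom.coe_coe, rename_X] at h
    rw [h]
    simp [Equiv.Perm.sign_swap hij]
  obtain ⟨q, hq⟩ := vand_dvd u hu
  have hV : φ (Matrix.vandermonde (X : Fin n → MvPolynomial (Fin n) ℚ)).det ≠ 0 := by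
    rw [Ne, map_eq_zero_iff φ hinj]
    exact Matrix.det_vandermonde_ne_zero_iff.2 X_injective
  have hVφ : φ (Matrix.vandermonde (X : Fin n → MvPolynomial (Fin n) ℚ)).det =
      (Matrix.vandermonde fun i => φ (X i)).det := by
    simp [vand_eq]
  have key : ∑ ω : Equiv.Perm (Fin n), factorialTerm mu (fun i => φ (X (ω i))) = φ q := by
    apply mul_right_cancel₀ hV
    rw [← map_mul, mul_comm q, ← hq, Finset.sum_mul]
    simp only [u, map_sum, map_mul, map_intCast]
    refine Finset.sum_congr rfl fun ω _ => ?_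
    have h1 := factorialTerm_mul_vand mu (fun i => φ (X (ω i)))
      (hinj.comp (X_injective.comp ω.injective))
    rw [vand_perm (fun i => φ (X i)) ω, ← hVφ] at h1
    rw [map_clearedTerm, ← h1]
    have hs : (((Equiv.Perm.sign ω : ℤ) : FractionRing (MvPolynomial (Fin n) ℚ))) *
        ((Equiv.Perm.sign ω : ℤ) : FractionRing (MvPolynomial (Fin n) ℚ)) = 1 := by
      rw [← Int.cast_mul, ← Units.val_mul, Int.units_mul_self]
      simp
    linear_combination (-(factorialTerm mu fun i => φ (X (ω i))) *
      φ (Matrix.vandermonde (X : Fin n → MvPolynomial (Fin n) ℚ)).det) * hs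
  refine ⟨C (1 / ((n - length mu).factorial : ℚ)) * q, ?_⟩
  rw [symmetrization, ← hφ, key, map_mul]
  congr 1
  have hC : φ (C (1 / ((n - length mu).factorial : ℚ))) =
      (φ.comp C) (1 / ((n - length mu).factorial : ℚ)) := rfl
  rw [hC, map_div₀, map_one, map_natCast]

end Existence

/-- Okounkov's factorial analogue of the Schur `P`-polynomial in `n` variables: the polynomial
equal to the symmetrization above if `length mu ≤ n`, and `0` otherwise. -/
noncomputable def factorialP {m : ℕ} (mu : m.Partition) (n : ℕ) : MvPolynomial (Fin n) ℚ :=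
  if length mu ≤ n then (exists_polynomial mu n).choose else 0

/-- The defining property of the polynomials. -/
theorem algebraMap_factorialP {m : ℕ} (mu : m.Partition) (n : ℕ) (h : length mu ≤ n) :
    algebraMap (MvPolynomial (Fin n) ℚ) (FractionRing (MvPolynomial (Fin n) ℚ))
      (factorialP mu n) = symmetrization mu n := by
  rw [factorialP, if_pos h]
  exact (exists_polynomial mu n).choose_spec

/-- The value at the point `(lam_1, …, lam_l)`, `l` being the length of `lam`. -/
noncomputable def factorialPAt {m k : ℕ} (mu : m.Partition) (lam : k.Partition) : ℚ :=
  MvPolynomial.eval (fun i : Fin (length lam) => (part lam i : ℚ)) (factorialP mu (length lam))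

end ShiftedDim

namespace ShiftedDim

open Finset

/-! Both sides solve the same recursion. In a labelling of `lam / mu` the largest label sits in a
removable corner, so `skewNum` at `N + 1` is the sum of `skewNum` at `N` over the strict sequences
obtained by lowering one part (`skewNum_succ`).

The algebraic counterpart is `skewW`: it strips the parts of `mu` by alternating expansions and ends
in the product `schurH`. It satisfies `∑ i, skewW (lower x i) = (|x| - |mu|) * skewW x`
(`sum_skewW_lower`), which for empty `mu` is Lagrange interpolation at the nodes `x (x - 1)`. It
vanishes when two neighbouring entries coincide (`skewW_eq_zero`), so the non-strict terms drop out,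
and at `|x| = |mu|` it is the indicator of `x = mu` (`skewW_of_sum_le`). Hence the dimension of `lam
/ mu` is `(k - m)! * skewW`, and `dim lam = k! * schurH`.

Finally, summing over permutations according to the image of the first index unrolls in the same way
as `skewW`, giving `skewW = schurH * P*_mu` (`skewW_eq_schurH_mul`). Dividing the two dimension
formulas proves the theorem. -/

/-! ### The product `schurH` and its lowering recursion. -/

theorem sum_prod_sub_div_prod_sub {n : ℕ} {F : Type*} [Field F] (u v : Fin n → F)
    (hu : Function.Injective u) :
    ∑ i, (∏ j, (u i - v j)) / ∏ j ∈ univ.erase i, (u i - u j) = ∑ i, (u i - v i) := by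
  classical
  rcases Nat.eq_zero_or_pos n with rfl | hn
  · simp
  have hcard : 0 < #(univ : Finset (Fin n)) := by simpa using hn
  let A : Polynomial F := ∏ j, (Polynomial.X - Polynomial.C (v j))
  let B : Polynomial F := ∏ j, (Polynomial.X - Polynomial.C (u j))
  have hA : A.Monic := Polynomial.monic_prod_of_monic _ _ fun j _ => Polynomial.monic_X_sub_C _
  have hB : B.Monic := Polynomial.monic_prod_of_monic _ _ fun j _ => Polynomial.monic_X_sub_C _
  have hdA : A.degree = n := by simp [A, Polynomial.degree_prod]
  have hdB : B.degree = n := by simp [B, Polynomial.degree_prod]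
  -- `A - B` has degree below `n` and agrees with `A` at the nodes, so Lagrange's formula for its
  -- coefficient of `X ^ (n - 1)` is the sum sought.
  have hdeg : (A - B).degree < #(univ : Finset (Fin n)) := by
    rw [card_univ, Fintype.card_fin, ← hdA]
    exact Polynomial.degree_sub_lt_left (hdA.trans hdB.symm) hA.ne_zero
      (hA.leadingCoeff.trans hB.leadingCoeff.symm)
  have h := Lagrange.coeff_eq_sum (s := univ) (v := u) hu.injOn hdeg
  have hev : ∀ i, (A - B).eval (u i) = ∏ j, (u i - v j) := by
    intro i
    have hz : B.eval (u i) = 0 := by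
      rw [Polynomial.eval_prod]
      exact prod_eq_zero (mem_univ i) (by simp)
    rw [Polynomial.eval_sub, hz, sub_zero, Polynomial.eval_prod]
    simp
  simp only [hev] at h
  rw [← h, Polynomial.coeff_sub, Polynomial.prod_X_sub_C_coeff_card_pred _ _ hcard,
    Polynomial.prod_X_sub_C_coeff_card_pred _ _ hcard, sum_sub_distrib]
  ring

/-- The reciprocal of `(a - m)!`, which is `0` if `a < m`. -/
noncomputable def invFac (a m : ℕ) : ℚ := if m ≤ a then 1 / ((a - m).factorial : ℚ) else 0

theorem invFac_of_lt {a m : ℕ} (h : a < m) : invFac a m = 0 := if_neg (not_le.2 h)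

theorem invFac_self (a : ℕ) : invFac a a = 1 := by simp [invFac]

/-- The convention that `invFac` vanishes below `m` makes this hold for `a ≤ m` too: at `a = m` the
factor `a - m` is zero. -/
theorem invFac_pred {a : ℕ} (m : ℕ) (ha : 0 < a) :
    invFac (a - 1) m = ((a : ℚ) - m) * invFac a m := by
  unfold invFac
  rcases lt_trichotomy a m with h | h | h
  · rw [if_neg (by omega), if_neg (by omega), mul_zero]
  · subst h
    rw [if_neg (by omega)]
    simp
  · obtain ⟨d, rfl⟩ := Nat.exists_eq_add_of_lt h
    rw [if_pos (by omega), if_pos (by omega)]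
    have e1 : m + d + 1 - 1 - m = d := by omega
    have e2 : m + d + 1 - m = d + 1 := by omega
    rw [e1, e2, Nat.factorial_succ]
    have := Nat.factorial_ne_zero d
    push_cast
    field_simp
    ring

theorem decFactorial_mul_invFac (a m : ℕ) :
    decFactorial (a : ℚ) m * invFac a 0 = invFac a m := by
  unfold decFactorial invFac
  rw [descPochhammer_eval_eq_descFactorial]
  simp only [Nat.zero_le, if_true, Nat.sub_zero]
  split_ifs with h
  · rw [← Nat.factorial_mul_descFactorial h]
    have h1 := Nat.factorial_ne_zero (a - m)
    have h2 : a.descFactorial m ≠ 0 := by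
      rw [Ne, Nat.descFactorial_eq_zero_iff_lt]
      omega
    push_cast
    field_simp
  · rw [Nat.descFactorial_eq_zero_iff_lt.2 (by omega)]
    simp

/-- The function `∏ 1 / x_i! * ∏_{i < j} (x_i - x_j) / (x_i + x_j)`. -/
noncomputable def schurH {n : ℕ} (x : Fin n → ℕ) : ℚ :=
  (∏ i, invFac (x i) 0) *
    ∏ i, ∏ j, if i < j then ((x i : ℚ) - x j) / (x i + x j) else 1

theorem prod_ite_succAbove_lt {n : ℕ} (i : Fin (n + 1)) :
    ∏ j : Fin n, (if i.succAbove j < i then (-1 : ℚ) else 1) = (-1) ^ (i : ℕ) := by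
  rw [prod_ite, prod_const_one, mul_one, prod_const]
  congr 1
  have : (univ.filter fun j : Fin n => i.succAbove j < i) = univ.filter fun j : Fin n => j < i.val := by
    ext j
    rw [mem_filter, mem_filter, Fin.succAbove_lt_iff_castSucc_lt, Fin.lt_def, Fin.val_castSucc]
  rw [this, Fin.card_filter_val_lt]
  omega

/-- The `i` pairs whose other index precedes `i` occur in reversed order, and each contributes a
factor `-1`. This is the sign in the expansion `skewW`. -/
theorem schurH_succAbove {n : ℕ} (x : Fin (n + 1) → ℕ) (i : Fin (n + 1)) :
    schurH x = (-1) ^ (i : ℕ) * invFac (x i) 0 *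
      (∏ j : Fin n, ((x i : ℚ) - x (i.succAbove j)) / (x i + x (i.succAbove j))) *
      schurH (x ∘ i.succAbove) := by
  have key : ∀ j : Fin n,
      (if i < i.succAbove j then ((x i : ℚ) - x (i.succAbove j)) / (x i + x (i.succAbove j)) else 1) *
      (if i.succAbove j < i then ((x (i.succAbove j) : ℚ) - x i) / (x (i.succAbove j) + x i) else 1) =
      (if i.succAbove j < i then (-1 : ℚ) else 1) *
        (((x i : ℚ) - x (i.succAbove j)) / (x i + x (i.succAbove j))) := by
    intro j
    rcases lt_or_gt_of_ne (Fin.succAbove_ne i j) with h | h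
    · rw [if_neg h.le.not_gt, if_pos h, if_pos h, add_comm (x i : ℚ), ← neg_sub (x i : ℚ)]
      ring
    · rw [if_pos h, if_neg h.le.not_gt, if_neg h.le.not_gt]
      ring
  unfold schurH
  rw [Fin.prod_univ_succAbove (fun i => invFac (x i) 0) i, Fin.prod_univ_succAbove _ i]
  conv_lhs => enter [2, 2, 2, j]; rw [Fin.prod_univ_succAbove _ i]
  rw [Fin.prod_univ_succAbove _ i, if_neg (lt_irrefl _), one_mul, prod_mul_distrib,
    ← prod_ite_succAbove_lt i]
  simp only [Function.comp, Fin.succAbove_lt_succAbove_iff]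
  have := prod_congr (rfl : (univ : Finset (Fin n)) = univ) fun j _ => key j
  rw [prod_mul_distrib, prod_mul_distrib] at this
  linear_combination (invFac (x i) 0 * (∏ j, invFac (x (i.succAbove j)) 0) *
    ∏ j : Fin n, ∏ k : Fin n, if j < k then ((x (i.succAbove j) : ℚ) - x (i.succAbove k)) /
      (x (i.succAbove j) + x (i.succAbove k)) else 1) * this

/-- Replacement of the entry `x i` by `x i - 1`. -/
def lower {n : ℕ} (x : Fin n → ℕ) (i : Fin n) : Fin n → ℕ := Function.update x i (x i - 1)

theorem lower_comp_self {n : ℕ} (x : Fin (n + 1) → ℕ) (i : Fin (n + 1)) :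
    lower x i ∘ i.succAbove = x ∘ i.succAbove := by
  funext j
  simp [lower, Fin.succAbove_ne]

theorem lower_comp {n : ℕ} (x : Fin (n + 1) → ℕ) (i : Fin (n + 1)) (j : Fin n) :
    lower x (i.succAbove j) ∘ i.succAbove = lower (x ∘ i.succAbove) j := by
  unfold lower
  rw [Function.update_comp_eq_of_injective _ Fin.succAbove_right_injective]
  rfl

/-- With `u = x (x - 1)` and `v = x (x + 1)` one has `u_i - v_j = (x_i + x_j)(x_i - 1 - x_j)` and
`u_i - u_j = (x_i - x_j)(x_i - 1 + x_j)`, so each pair factor changes by `(u_i - v_j) / (u_i -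
u_j)`. -/
theorem schurH_lower {n : ℕ} (x : Fin (n + 1) → ℕ) (hpos : ∀ i, 0 < x i)
    (hinj : Function.Injective x) (i : Fin (n + 1)) :
    schurH (lower x i) = schurH x * (x i * ∏ j : Fin n,
      (((x i : ℚ) * (x i - 1) - x (i.succAbove j) * (x (i.succAbove j) + 1)) /
        ((x i : ℚ) * (x i - 1) - x (i.succAbove j) * (x (i.succAbove j) - 1)))) := by
  rw [schurH_succAbove x i, schurH_succAbove (lower x i) i, lower_comp_self]
  have h1 : lower x i i = x i - 1 := by simp [lower]
  have h2 : ∀ j, lower x i (i.succAbove j) = x (i.succAbove j) := by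
    intro j
    simp [lower, Fin.succAbove_ne]
  rw [h1, invFac_pred _ (hpos i)]
  simp only [h2, Nat.cast_pred (hpos i)]
  have key : ∀ j : Fin n, ((x i : ℚ) - 1 - x (i.succAbove j)) / (x i - 1 + x (i.succAbove j)) =
      (((x i : ℚ) - x (i.succAbove j)) / (x i + x (i.succAbove j))) *
      (((x i : ℚ) * (x i - 1) - x (i.succAbove j) * (x (i.succAbove j) + 1)) /
        ((x i : ℚ) * (x i - 1) - x (i.succAbove j) * (x (i.succAbove j) - 1))) := by
    intro j
    have hi : (1 : ℚ) ≤ x i := by exact_mod_cast hpos i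
    have hj : (1 : ℚ) ≤ x (i.succAbove j) := by exact_mod_cast hpos _
    have hne : (x i : ℚ) - x (i.succAbove j) ≠ 0 := by
      rw [sub_ne_zero]
      exact_mod_cast fun e => Fin.succAbove_ne i j (hinj e).symm
    have e1 : (x i : ℚ) * (x i - 1) - x (i.succAbove j) * (x (i.succAbove j) - 1) =
      (x i - x (i.succAbove j)) * (x i - 1 + x (i.succAbove j)) := by ring
    have e2 : (x i : ℚ) * (x i - 1) - x (i.succAbove j) * (x (i.succAbove j) + 1) =
      (x i + x (i.succAbove j)) * (x i - 1 - x (i.succAbove j)) := by ring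
    have hs : (x i : ℚ) + x (i.succAbove j) ≠ 0 := by linarith
    have hs' : (x i : ℚ) - 1 + x (i.succAbove j) ≠ 0 := by linarith
    rw [e1, e2]
    field_simp
  simp only [key, prod_mul_distrib]
  push_cast
  ring

theorem sum_schurH_lower {n : ℕ} (x : Fin n → ℕ) (hpos : ∀ i, 0 < x i)
    (hinj : Function.Injective x) :
    ∑ i, schurH (lower x i) = (∑ i, (x i : ℚ)) * schurH x := by
  cases n with
  | zero => simp
  | succ n =>
    let u : Fin (n + 1) → ℚ := fun i => (x i : ℚ) * (x i - 1)
    let v : Fin (n + 1) → ℚ := fun i => (x i : ℚ) * (x i + 1)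
    have hu : Function.Injective u := by
      intro i j hij
      apply hinj
      have hi : (1 : ℚ) ≤ x i := by exact_mod_cast hpos i
      have hj : (1 : ℚ) ≤ x j := by exact_mod_cast hpos j
      have h : ((x i : ℚ) - x j) * (x i - 1 + x j) = 0 := by
        simp only [u] at hij
        linear_combination hij
      have hs : (x i : ℚ) - 1 + x j ≠ 0 := by linarith
      exact_mod_cast sub_eq_zero.1 ((mul_eq_zero.1 h).resolve_right hs)
    have h := sum_prod_sub_div_prod_sub u v hu
    -- The factor `j = i` of the numerator is `u i - v i = -2 * x i`; the constant `-2` also appears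
    -- in `∑ (u i - v i)` and cancels.
    have e : ∀ i, (∏ j, (u i - v j)) / ∏ j ∈ univ.erase i, (u i - u j) =
        -2 * (x i * ∏ j : Fin n,
          ((u i - v (i.succAbove j)) / (u i - u (i.succAbove j)))) := by
      intro i
      have e1 : univ.erase i = univ.image i.succAbove := by
        rw [Fin.image_succAbove_univ, compl_eq_univ_sdiff, sdiff_singleton_eq_erase]
      rw [Fin.prod_univ_succAbove _ i, e1, prod_image fun _ _ _ _ e =>
        Fin.succAbove_right_injective e, prod_div_distrib]
      simp only [u, v]
      ring
    simp only [e, ← mul_sum] at h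
    have e2 : ∑ i, (u i - v i) = -2 * ∑ i, (x i : ℚ) := by
      rw [mul_sum]
      exact sum_congr rfl fun i _ => by ring
    rw [e2] at h
    simp only [u, v] at h
    rw [sum_congr rfl fun i _ => schurH_lower x hpos hinj i, ← mul_sum, mul_comm]
    congr 1
    exact mul_left_cancel₀ (by norm_num) h

theorem schurH_eq_zero {n : ℕ} (x : Fin n → ℕ) {i j : Fin n} (hij : i < j) (h : x i = x j) :
    schurH x = 0 := by
  unfold schurH
  refine mul_eq_zero_of_right _ (prod_eq_zero (mem_univ i) (prod_eq_zero (mem_univ j) ?_))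
  simp [hij, h]

/-- A zero entry gives pair factors `x_i / x_i`; positivity of the others is needed because `0 / 0 =
0`. -/
theorem schurH_last {n : ℕ} (x : Fin (n + 1) → ℕ) (hlast : x (Fin.last n) = 0)
    (hpos : ∀ i : Fin n, 0 < x i.castSucc) : schurH x = schurH (x ∘ Fin.castSucc) := by
  have h0 : invFac 0 0 = 1 := invFac_self 0
  unfold schurH
  rw [Fin.prod_univ_castSucc, hlast, h0, mul_one, Fin.prod_univ_castSucc]
  congr 1
  rw [prod_eq_one (s := univ) (f := fun j => if Fin.last n < j then _ else (1 : ℚ))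
    fun j _ => if_neg (Fin.le_last j).not_gt, mul_one]
  refine prod_congr rfl fun i _ => ?_
  rw [Fin.prod_univ_castSucc, hlast]
  have : (x i.castSucc : ℚ) ≠ 0 := by exact_mod_cast (hpos i).ne'
  simp [this, Fin.castSucc_lt_last]

/-! ### The expansion `skewW`: recursion, vanishing, stability, boundary values. -/

/-- The iterated Laplace expansion that equals the number of shifted standard tableaux of shape
`x / mu` divided by the factorial of the number of cells. -/
noncomputable def skewW : List ℕ → (n : ℕ) → (Fin n → ℕ) → ℚ
  | [], _, x => schurH x
  | _ :: _, 0, _ => 0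
  | m :: mu, n + 1, x =>
    ∑ i : Fin (n + 1), (-1) ^ (i : ℕ) * invFac (x i) m * skewW mu n (x ∘ i.succAbove)

/-- In the term that deletes entry `i`, lowering that entry multiplies by `x i - m`, while lowering
the others multiplies by their sum minus `mu.sum`, by induction. The two factors add up to the same
total for every `i`. -/
theorem sum_skewW_lower (mu : List ℕ) {n : ℕ} (x : Fin n → ℕ) (hpos : ∀ i, 0 < x i)
    (hinj : Function.Injective x) :
    ∑ i, skewW mu n (lower x i) = ((∑ i, (x i : ℚ)) - mu.sum) * skewW mu n x := by
  induction mu generalizing n with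
  | nil => simpa [skewW] using sum_schurH_lower x hpos hinj
  | cons m mu ih =>
    cases n with
    | zero => simp [skewW]
    | succ n =>
      simp only [skewW]
      rw [sum_comm, mul_sum]
      refine sum_congr rfl fun i _ => ?_
      have h := ih (x ∘ i.succAbove) (fun _ => hpos _)
        (hinj.comp Fin.succAbove_right_injective)
      rw [Fin.sum_univ_succAbove _ i, lower_comp_self]
      have h1 : lower x i i = x i - 1 := by simp [lower]
      have h2 : ∀ j : Fin n, lower x (i.succAbove j) i = x i := by
        intro j
        simp [lower, (Fin.succAbove_ne i j).symm]
      simp only [h1, h2, lower_comp, ← mul_sum, h]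
      rw [invFac_pred _ (hpos i), Fin.sum_univ_succAbove _ i]
      simp only [Function.comp, List.sum_cons]
      push_cast
      ring

/-- The terms deleting `i` and `i + 1` leave the same sequence and have opposite signs. In every
other term the equal entries stay adjacent, so induction applies. -/
theorem skewW_eq_zero (mu : List ℕ) {n : ℕ} (x : Fin n → ℕ) {i j : Fin n}
    (hij : (j : ℕ) = i + 1) (h : x i = x j) : skewW mu n x = 0 := by
  induction mu generalizing n with
  | nil => exact schurH_eq_zero x (Fin.lt_def.2 (by omega)) h
  | cons m mu ih =>
    cases n with
    | zero => rfl
    | succ n =>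
      simp only [skewW]
      have hne : i ≠ j := by
        rintro rfl
        omega
      rw [sum_eq_add i j hne]
      · have e : x ∘ i.succAbove = x ∘ j.succAbove := by
          funext k
          simp only [Function.comp]
          rcases eq_or_ne (k : ℕ) i with hk | hk
          · have e1 : i.succAbove k = j := by
              ext
              simp [Fin.succAbove, Fin.lt_def, hk, hij]
            have e2 : j.succAbove k = i := by
              ext
              simp [Fin.succAbove, Fin.lt_def, hk, hij]
            rw [e1, e2, h]
          · congr 1
            ext
            simp only [Fin.succAbove, Fin.lt_def, Fin.val_castSucc, hij]
            split_ifs <;> first | rfl | omega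
        rw [e, h, hij]
        ring
      · intro a _ ha
        obtain ⟨i', hi'⟩ := Fin.exists_succAbove_eq ha.1.symm
        obtain ⟨j', hj'⟩ := Fin.exists_succAbove_eq ha.2.symm
        rw [ih (x ∘ a.succAbove) (i := i') (j := j'), mul_zero]
        · have ha1 : (a : ℕ) ≠ i := fun e => ha.1 (Fin.ext e)
          have ha2 : (a : ℕ) ≠ j := fun e => ha.2 (Fin.ext e)
          have hi2 := congrArg Fin.val hi'
          have hj2 := congrArg Fin.val hj'
          simp only [Fin.succAbove, Fin.lt_def, Fin.val_castSucc] at hi2 hj2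
          split_ifs at hi2 hj2 <;> simp at hi2 hj2 <;> omega
        · simp only [Function.comp, hi', hj', h]
      · simp
      · simp

theorem skewW_last (mu : List ℕ) {n : ℕ} (x : Fin (n + 1) → ℕ) (hmu : ∀ m ∈ mu, 0 < m)
    (hlast : x (Fin.last n) = 0) (hpos : ∀ i : Fin n, 0 < x i.castSucc) :
    skewW mu (n + 1) x = skewW mu n (x ∘ Fin.castSucc) := by
  induction mu generalizing n with
  | nil => exact schurH_last x hlast hpos
  | cons m mu ih =>
    have hm : invFac 0 m = 0 := invFac_of_lt (hmu m (by simp))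
    rw [skewW, Fin.sum_univ_castSucc, hlast, hm, mul_zero, zero_mul, add_zero]
    cases n with
    | zero => simp [skewW]
    | succ n =>
      rw [skewW]
      refine sum_congr rfl fun i _ => ?_
      rw [ih (x ∘ i.castSucc.succAbove) (fun m hm => hmu m (by simp [hm]))]
      · simp only [Function.comp_def, Fin.castSucc_succAbove_castSucc, Fin.val_castSucc]
      · simp only [Function.comp]
        rw [Fin.succAbove_ne_last_last (Fin.castSucc_lt_last i).ne, hlast]
      · intro j
        simp only [Function.comp, Fin.castSucc_succAbove_castSucc]
        exact hpos _

/-- The hypothesis is an inequality so that it survives the induction: deleting an entry `x i ≥ m`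
leaves a sum at most that of the tail of `mu`. -/
theorem skewW_of_sum_le (mu : List ℕ) {n : ℕ} (x : Fin n → ℕ) (hmu : mu.Pairwise (· > ·))
    (hx : StrictAnti x) (hpos : ∀ i, 0 < x i) (hsum : ∑ i, x i ≤ mu.sum) :
    skewW mu n x = if List.ofFn x = mu then 1 else 0 := by
  induction mu generalizing n with
  | nil =>
    cases n with
    | zero => simp [skewW, schurH]
    | succ n =>
      exfalso
      have := single_le_sum (f := x) (fun i _ => Nat.zero_le _) (mem_univ 0)
      have := hpos 0
      rw [List.sum_nil] at hsum
      omega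
  | cons m mu ih =>
    cases n with
    | zero => simp [skewW]
    | succ n =>
      rw [List.pairwise_cons] at hmu
      rw [skewW]
      have hs : ∀ i, x i + ∑ j : Fin n, (x ∘ i.succAbove) j ≤ m + mu.sum := by
        intro i
        simp only [Function.comp]
        rwa [← Fin.sum_univ_succAbove _ i, ← List.sum_cons]
      have hI : ∀ i, m ≤ x i → skewW mu n (x ∘ i.succAbove) =
          if List.ofFn (x ∘ i.succAbove) = mu then 1 else 0 := fun i hi =>
        ih _ hmu.2 (hx.comp_strictMono (Fin.strictMono_succAbove i)) (fun _ => hpos _)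
          (by have := hs i; omega)
      have hz : ∀ i, ¬ (x i = m ∧ List.ofFn (x ∘ i.succAbove) = mu) →
          (-1) ^ (i : ℕ) * invFac (x i) m * skewW mu n (x ∘ i.succAbove) = 0 := by
        intro i hi
        rcases lt_trichotomy (x i) m with h | h | h
        · simp [invFac_of_lt h]
        · rw [hI i h.ge, if_neg fun e => hi ⟨h, e⟩, mul_zero]
        · rw [hI i h.le, if_neg, mul_zero]
          intro e
          have := hs i
          rw [← e, List.sum_ofFn] at this
          omega
      rw [sum_eq_single 0]
      · have e0 : List.ofFn x = x 0 :: List.ofFn (x ∘ (0 : Fin (n + 1)).succAbove) := by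
          rw [List.ofFn_succ]
          rfl
        rw [e0]
        split_ifs with h
        · rw [List.cons.injEq] at h
          rw [hI 0 h.1.ge, if_pos h.2, h.1, invFac_self]
          simp
        · exact hz 0 fun e => h (by rw [e.1, e.2])
      -- If `i ≠ 0`, then `x 0` belongs to the tail of `mu`, so `x 0 < m = x i`, against the strict
      -- decrease of `x`.
      · intro i _ hi
        refine hz i fun e => ?_
        have hi0 : (0 : Fin (n + 1)) < i := Fin.pos_iff_ne_zero.2 hi
        obtain ⟨k, hk⟩ := Fin.exists_succAbove_eq hi.symm
        have h1 : x 0 ∈ mu := by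
          rw [← e.2, List.mem_ofFn]
          exact ⟨k, by simp [hk]⟩
        have h2 := hmu.1 _ h1
        have h3 := hx hi0
        omega
      · simp

/-! ### Factorization of `skewW` through the factorial `P`-polynomial. -/

/-- The analogue of `factorialTerm` for an arbitrary list of exponents. -/
noncomputable def listTerm (mu : List ℕ) {n : ℕ} (x : Fin n → ℚ) : ℚ :=
  (∏ i : Fin n with i.val < mu.length, decFactorial (x i) (mu.getD i 0)) *
    ∏ p : Fin n × Fin n with p.1.val < mu.length ∧ p.1 < p.2,
      (x p.1 + x p.2) / (x p.1 - x p.2)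

theorem listTerm_nil {n : ℕ} (x : Fin n → ℚ) : listTerm [] x = 1 := by
  simp [listTerm]

theorem listTerm_cons (m : ℕ) (mu : List ℕ) {n : ℕ} (x : Fin (n + 1) → ℚ) :
    listTerm (m :: mu) x = decFactorial (x 0) m *
      (∏ j : Fin n, (x 0 + x j.succ) / (x 0 - x j.succ)) * listTerm mu (fun j => x j.succ) := by
  simp only [listTerm, prod_filter, Fintype.prod_prod_type]
  rw [Fin.prod_univ_succ, Fin.prod_univ_succ (n := n) (f := fun i => ∏ j, _),
    Fin.prod_univ_succ (n := n) (f := fun j => ite _ _ _)]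
  simp only [Fin.prod_univ_succ (n := n) (f := fun j => ite (_ ∧ Fin.succ _ < j) _ _)]
  simp [Fin.succ_lt_succ_iff]
  ring

/-- The sum of `listTerm` over all permutations of the variables. -/
noncomputable def symSum (mu : List ℕ) {n : ℕ} (x : Fin n → ℚ) : ℚ :=
  ∑ ω : Equiv.Perm (Fin n), listTerm mu fun i => x (ω i)

/-- `decomposeFin` enumerates the complement of `p` by a transposition, the expansion by
`succAbove`; `τ` reconciles the two. -/
theorem exists_perm_swap_zero_succ {n : ℕ} (p : Fin (n + 1)) :
    ∃ τ : Equiv.Perm (Fin n), ∀ j : Fin n, Equiv.swap 0 p j.succ = p.succAbove (τ j) := by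
  refine Fin.cases ⟨1, fun j => by simp⟩ (fun i => ⟨i.cycleRange, fun j => ?_⟩) p
  rw [Fin.succAbove_cycleRange]

theorem symSum_cons (m : ℕ) (mu : List ℕ) {n : ℕ} (x : Fin (n + 1) → ℚ) :
    symSum (m :: mu) x = ∑ p : Fin (n + 1), decFactorial (x p) m *
      (∏ j : Fin n, (x p + x (p.succAbove j)) / (x p - x (p.succAbove j))) *
      symSum mu fun j => x (p.succAbove j) := by
  unfold symSum
  rw [← Equiv.sum_comp Equiv.Perm.decomposeFin.symm, Fintype.sum_prod_type]
  refine sum_congr rfl fun p _ => ?_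
  obtain ⟨τ, hτ⟩ := exists_perm_swap_zero_succ p
  conv_rhs => rw [← Equiv.sum_comp (Equiv.mulLeft τ), mul_sum]
  refine sum_congr rfl fun e _ => ?_
  rw [listTerm_cons]
  simp only [Equiv.Perm.decomposeFin_symm_apply_zero, Equiv.Perm.decomposeFin_symm_apply_succ, hτ,
    Equiv.coe_mulLeft, Equiv.Perm.mul_apply]
  congr 2
  exact Equiv.prod_comp (τ * e : Equiv.Perm (Fin n))
    fun j => (x p + x (p.succAbove j)) / (x p - x (p.succAbove j))

/-- The pair factors split off from `schurH` are the reciprocals of those split off from `symSum`,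
and `n - mu.length` does not change along the recursion. For empty `mu` the `n!` equal terms cancel
the normalization. -/
theorem skewW_eq_schurH_mul (mu : List ℕ) {n : ℕ} (x : Fin n → ℕ) (hinj : Function.Injective x)
    (hn : mu.length ≤ n) :
    skewW mu n x = schurH x *
      (1 / ((n - mu.length).factorial : ℚ) * symSum mu fun i => (x i : ℚ)) := by
  induction mu generalizing n with
  | nil =>
    have := Nat.factorial_ne_zero n
    simp only [skewW, symSum, listTerm_nil, sum_const, card_univ, Fintype.card_perm,
      Fintype.card_fin, List.length_nil, Nat.sub_zero, nsmul_eq_mul, mul_one]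
    field_simp
  | cons m mu ih =>
    cases n with
    | zero => simp at hn
    | succ n =>
      rw [skewW, symSum_cons, mul_sum, mul_sum]
      refine sum_congr rfl fun i _ => ?_
      rw [ih _ (hinj.comp Fin.succAbove_right_injective) (by simpa using hn),
        ← decFactorial_mul_invFac, schurH_succAbove x i]
      have h1 : (∏ j : Fin n, ((x i : ℚ) - x (i.succAbove j)) / (x i + x (i.succAbove j))) *
          ∏ j : Fin n, ((x i : ℚ) + x (i.succAbove j)) / (x i - x (i.succAbove j)) = 1 := by
        rw [← prod_mul_distrib]
        refine prod_eq_one fun j _ => ?_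
        have hne : x i ≠ x (i.succAbove j) := fun e => Fin.succAbove_ne i j (hinj e).symm
        have h2 : (x i : ℚ) - x (i.succAbove j) ≠ 0 := sub_ne_zero.2 (by exact_mod_cast hne)
        have h3 : (x i : ℚ) + x (i.succAbove j) ≠ 0 := by
          have : x i + x (i.succAbove j) ≠ 0 := by omega
          exact_mod_cast this
        field_simp
      simp only [List.length_cons, Nat.add_sub_add_right, Function.comp]
      set S := symSum mu fun j => (x (i.succAbove j) : ℚ)
      set H := schurH fun j => x (i.succAbove j)
      have hH : schurH (x ∘ i.succAbove) = H := rfl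
      rw [hH]
      linear_combination (-(-1) ^ (i : ℕ) * invFac (x i) 0 * H *
        (1 / ((n - mu.length).factorial : ℚ)) * decFactorial (x i : ℚ) m * S) * h1

/-- The parts of a partition in weakly decreasing order. -/
def partList {k : ℕ} (lam : k.Partition) : List ℕ := lam.parts.sort (· ≥ ·)

theorem length_partList {k : ℕ} (lam : k.Partition) : (partList lam).length = length lam :=
  Multiset.length_sort ..

theorem factorialTerm_eq_listTerm {m : ℕ} (mu : m.Partition) {n : ℕ} (x : Fin n → ℚ) :
    factorialTerm mu x = listTerm (partList mu) x := by
  rw [factorialTerm, listTerm, length_partList]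
  rfl

open MvPolynomial in
-- The defining identity lives in the fraction field, where evaluation is unavailable. Multiplying
-- by the Vandermonde determinant turns it into a polynomial identity; at a point with distinct
-- coordinates the determinant can be divided out again.
theorem eval_factorialP {m : ℕ} (mu : m.Partition) {n : ℕ} (hn : length mu ≤ n) (x : Fin n → ℚ)
    (hx : Function.Injective x) :
    eval x (factorialP mu n) =
      1 / ((n - length mu).factorial : ℚ) * ∑ ω : Equiv.Perm (Fin n),
        factorialTerm mu fun i => x (ω i) := by
  set φ := algebraMap (MvPolynomial (Fin n) ℚ) (FractionRing (MvPolynomial (Fin n) ℚ)) with hφ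
  have hinj : Function.Injective φ := IsFractionRing.injective _ _
  have hVφ : φ (Matrix.vandermonde (X : Fin n → MvPolynomial (Fin n) ℚ)).det =
      (Matrix.vandermonde fun i => φ (X i)).det := by
    simp [vand_eq]
  have hfac : ((n - length mu).factorial : ℚ) ≠ 0 := by
    exact_mod_cast Nat.factorial_ne_zero _
  have cleared : ∀ {K : Type} [Field K] (y : Fin n → K), Function.Injective y →
      (∑ ω : Equiv.Perm (Fin n), factorialTerm mu fun i => y (ω i)) * (Matrix.vandermonde y).det =
      ∑ ω : Equiv.Perm (Fin n), ((Equiv.Perm.sign ω : ℤ) : K) * clearedTerm mu fun i => y (ω i) := by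
    intro K _ y hy
    rw [sum_mul]
    refine sum_congr rfl fun ω _ => ?_
    have h1 := factorialTerm_mul_vand mu (fun i => y (ω i)) (hy.comp ω.injective)
    rw [vand_perm y ω] at h1
    rw [← h1]
    have hs : (((Equiv.Perm.sign ω : ℤ) : K)) * ((Equiv.Perm.sign ω : ℤ) : K) = 1 := by
      rw [← Int.cast_mul, ← Units.val_mul, Int.units_mul_self]
      simp
    linear_combination (-(factorialTerm mu fun i => y (ω i)) * (Matrix.vandermonde y).det) * hs
  have hpoly : ((n - length mu).factorial : MvPolynomial (Fin n) ℚ) * factorialP mu n *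
      (Matrix.vandermonde (X : Fin n → MvPolynomial (Fin n) ℚ)).det =
      ∑ ω : Equiv.Perm (Fin n), ((Equiv.Perm.sign ω : ℤ) : MvPolynomial (Fin n) ℚ) *
        clearedTerm mu fun i => X (ω i) := by
    apply hinj
    have hf : ((n - length mu).factorial : FractionRing (MvPolynomial (Fin n) ℚ)) ≠ 0 := by
      exact_mod_cast Nat.factorial_ne_zero _
    simp only [map_mul, map_sum, map_intCast, map_natCast, map_clearedTerm]
    rw [← cleared (fun i => φ (X i)) (hinj.comp X_injective), hVφ, algebraMap_factorialP mu n hn,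
      symmetrization]
    field_simp
    exact mul_comm _ _
  have he := congrArg (eval x) hpoly
  simp only [map_mul, map_sum, map_intCast, map_natCast, map_clearedTerm, eval_X] at he
  have hV : eval x (Matrix.vandermonde (X : Fin n → MvPolynomial (Fin n) ℚ)).det =
      (Matrix.vandermonde x).det := by
    simp [vand_eq]
  rw [← cleared x hx, hV] at he
  have hne : (Matrix.vandermonde x).det ≠ 0 := Matrix.det_vandermonde_ne_zero_iff.2 hx
  have he' := mul_right_cancel₀ hne he
  rw [← he']
  field_simp

theorem skewW_partList {m k : ℕ} (mu : m.Partition) (lam : k.Partition)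
    (hlam : Function.Injective fun i : Fin (length lam) => part lam i) :
    skewW (partList mu) (length lam) (fun i => part lam i) =
      schurH (fun i : Fin (length lam) => part lam i) * factorialPAt mu lam := by
  unfold factorialPAt
  by_cases h : length mu ≤ length lam
  · have hc : Function.Injective fun i : Fin (length lam) => (part lam i : ℚ) :=
      Nat.cast_injective.comp hlam
    rw [skewW_eq_schurH_mul _ _ hlam (by rwa [length_partList]), eval_factorialP mu h _ hc,
      length_partList]
    simp only [factorialTerm_eq_listTerm, symSum]
  -- If `mu` is longer than `lam`, the expansion runs out of variables, matching the convention that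
  -- the polynomial is `0`.
  · have hz : ∀ (L : List ℕ) (n : ℕ) (x : Fin n → ℕ), n < L.length → skewW L n x = 0 := by
      intro L
      induction L with
      | nil => intro n x hn; simp at hn
      | cons a L ih =>
        intro n x hn
        cases n with
        | zero => rfl
        | succ n =>
          rw [skewW]
          exact sum_eq_zero fun i _ => by rw [ih _ _ (by simpa using hn), mul_zero]
    rw [hz _ _ _ (by rw [length_partList]; omega), factorialP, if_neg h, map_zero, mul_zero]

/-! ### Standard labellings and removal of the largest label. -/

/-- The relation between two cells in the same row or column that forces their labels to
increase. -/
def cellLT (c d : ℕ × ℕ) : Prop := (c.1 = d.1 ∧ c.2 < d.2) ∨ (c.2 = d.2 ∧ c.1 < d.1)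

/-- Standard labellings of a set of cells by `1, …, N`, extended by `0` to all cells. -/
def IsLabelling (A : Set (ℕ × ℕ)) (N : ℕ) (t : ℕ × ℕ → ℕ) : Prop :=
  (∀ c, c ∉ A → t c = 0) ∧ Set.BijOn t A (Set.Icc 1 N) ∧
    ∀ c ∈ A, ∀ d ∈ A, cellLT c d → t c < t d

/-- The number of standard labellings of a set of cells by `1, …, N`. -/
noncomputable def numLabellings (A : Set (ℕ × ℕ)) (N : ℕ) : ℕ := Nat.card {t // IsLabelling A N t}

theorem finite_labellings (A : Set (ℕ × ℕ)) (N : ℕ) : Finite {t // IsLabelling A N t} := by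
  have : Finite (A ≃ Set.Icc 1 N) := Equiv.finite_right
  refine Finite.of_injective
    (fun t : {t // IsLabelling A N t} => Set.BijOn.equiv t.1 t.2.2.1) ?_
  intro t s h
  ext c
  by_cases hc : c ∈ A
  · exact congrArg Subtype.val (DFunLike.congr_fun h ⟨c, hc⟩)
  · rw [t.2.1 c hc, s.2.1 c hc]

theorem IsLabelling.le {A : Set (ℕ × ℕ)} {N : ℕ} {t : ℕ × ℕ → ℕ} (ht : IsLabelling A N t)
    (c : ℕ × ℕ) : t c ≤ N := by
  by_cases hc : c ∈ A
  · exact (ht.2.1.mapsTo hc).2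
  · rw [ht.1 c hc]
    exact Nat.zero_le _

theorem IsLabelling.update_succ {A : Set (ℕ × ℕ)} {N : ℕ} {c : ℕ × ℕ} (hc : c ∈ A)
    (hmax : ∀ d ∈ A, ¬ cellLT c d) {s : ℕ × ℕ → ℕ} (hs : IsLabelling (A \ {c}) N s) :
    IsLabelling A (N + 1) (Function.update s c (N + 1)) := by
  obtain ⟨h0, ⟨hm, hi, hsurj⟩, hlt⟩ := hs
  have hne : ∀ d ∈ A, d ≠ c → Function.update s c (N + 1) d = s d ∧ 1 ≤ s d ∧ s d ≤ N := by
    intro d hd hdc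
    exact ⟨Function.update_of_ne hdc _ _, hm ⟨hd, hdc⟩⟩
  have hself : Function.update s c (N + 1) c = N + 1 := Function.update_self _ _ _
  refine ⟨?_, ⟨?_, ?_, ?_⟩, ?_⟩
  · intro d hd
    have hdc : d ≠ c := fun e => hd (e ▸ hc)
    rw [Function.update_of_ne hdc]
    exact h0 d fun h => hd h.1
  · intro d hd
    rcases eq_or_ne d c with rfl | hdc
    · rw [hself]
      exact ⟨by omega, le_rfl⟩
    · obtain ⟨e, h1, h2⟩ := hne d hd hdc
      rw [e]
      exact ⟨h1, by omega⟩
  · intro d hd e he hde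
    rcases eq_or_ne d c with rfl | hdc <;> rcases eq_or_ne e d with rfl | hed
    · rfl
    · obtain ⟨h1, h2, h3⟩ := hne e he hed
      rw [hself, h1] at hde
      omega
    · rfl
    · obtain ⟨h1, h2, h3⟩ := hne d hd hdc
      rcases eq_or_ne e c with rfl | hec
      · rw [hself, h1] at hde
        omega
      · rw [h1, (hne e he hec).1] at hde
        exact hi ⟨hd, hdc⟩ ⟨he, hec⟩ hde
  · rintro b ⟨hb1, hb2⟩
    rcases eq_or_ne b (N + 1) with rfl | hb
    · exact ⟨c, hc, hself⟩
    · obtain ⟨d, hd, rfl⟩ := hsurj (show b ∈ Set.Icc 1 N from ⟨hb1, by omega⟩)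
      exact ⟨d, hd.1, (hne d hd.1 hd.2).1⟩
  · intro d hd e he hde
    have hdc : d ≠ c := by
      rintro rfl
      exact hmax e he hde
    obtain ⟨h1, h2, h3⟩ := hne d hd hdc
    rcases eq_or_ne e c with rfl | hec
    · rw [h1, hself]
      omega
    · rw [h1, (hne e he hec).1]
      exact hlt d ⟨hd, hdc⟩ e ⟨he, hec⟩ hde

theorem IsLabelling.update_zero {A : Set (ℕ × ℕ)} {N : ℕ} {c : ℕ × ℕ} (hc : c ∈ A)
    {t : ℕ × ℕ → ℕ} (ht : IsLabelling A (N + 1) t) (htc : t c = N + 1) :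
    IsLabelling (A \ {c}) N (Function.update t c 0) := by
  obtain ⟨h0, ⟨hm, hi, hsurj⟩, hlt⟩ := ht
  have hne : ∀ d, d ≠ c → Function.update t c 0 d = t d := fun d hdc =>
    Function.update_of_ne hdc _ _
  refine ⟨?_, ⟨?_, ?_, ?_⟩, ?_⟩
  · intro d hd
    rcases eq_or_ne d c with rfl | hdc
    · exact Function.update_self _ _ _
    · rw [hne d hdc]
      exact h0 d fun h => hd ⟨h, hdc⟩
  · rintro d ⟨hd, hdc⟩
    rw [hne d hdc]
    obtain ⟨h1, h2⟩ := hm hd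
    refine ⟨h1, ?_⟩
    have : t d ≠ N + 1 := fun e => hdc (hi hd hc (e.trans htc.symm))
    omega
  · rintro d ⟨hd, hdc⟩ e ⟨he, hec⟩ hde
    rw [hne d hdc, hne e hec] at hde
    exact hi hd he hde
  · rintro b ⟨hb1, hb2⟩
    obtain ⟨d, hd, rfl⟩ := hsurj (show b ∈ Set.Icc 1 (N + 1) from ⟨hb1, by omega⟩)
    have hdc : d ≠ c := by
      rintro rfl
      omega
    exact ⟨d, ⟨hd, hdc⟩, hne d hdc⟩
  · rintro d ⟨hd, hdc⟩ e ⟨he, hec⟩ hde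
    rw [hne d hdc, hne e hec]
    exact hlt d hd e he hde

/-- The label `N + 1` must occupy a maximal cell, and any maximal cell can carry it; erasing it is a
bijection onto labellings of the remaining cells. -/
theorem numLabellings_succ {A : Set (ℕ × ℕ)} {ι : Type*} (R : Finset ι) (c : ι → ℕ × ℕ)
    (hc : Function.Injective c)
    (h : ∀ d, (d ∈ A ∧ ∀ e ∈ A, ¬ cellLT d e) ↔ ∃ i ∈ R, c i = d) (N : ℕ) :
    numLabellings A (N + 1) = ∑ i ∈ R, numLabellings (A \ {c i}) N := by
  have hR : ∀ i : R, c i ∈ A ∧ ∀ e ∈ A, ¬ cellLT (c i) e := fun i => (h _).2 ⟨i, i.2, rfl⟩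
  let F : (Σ i : R, {s // IsLabelling (A \ {c i}) N s}) → {t // IsLabelling A (N + 1) t} :=
    fun p => ⟨Function.update p.2.1 (c p.1) (N + 1), p.2.2.update_succ (hR p.1).1 (hR p.1).2⟩
  have hF : Function.Bijective F := by
    constructor
    · rintro ⟨i, s, hs⟩ ⟨j, s', hs'⟩ e
      have e1 : Function.update s (c i) (N + 1) = Function.update s' (c j) (N + 1) :=
        congrArg Subtype.val e
      -- Otherwise the label `N + 1` at `c j` would be a value of `s`, which is bounded by `N`.
      have hij : i = j := by
        by_contra hne
        have hcne : c j ≠ c i := fun e => hne (Subtype.ext (hc e)).symm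
        have e2 := congrFun e1 (c j)
        rw [Function.update_self, Function.update_of_ne hcne] at e2
        have := hs.le (c j)
        omega
      subst hij
      have hss : s = s' := by
        funext d
        rcases eq_or_ne d (c i) with rfl | hd
        · rw [hs.1 _ fun h => h.2 rfl, hs'.1 _ fun h => h.2 rfl]
        · have e2 := congrFun e1 d
          rwa [Function.update_of_ne hd, Function.update_of_ne hd] at e2
      subst hss
      rfl
    · rintro ⟨t, ht⟩
      obtain ⟨d, hd, htd⟩ := ht.2.1.surjOn (show N + 1 ∈ Set.Icc 1 (N + 1) from ⟨by omega, le_rfl⟩)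
      obtain ⟨i, hi, rfl⟩ := (h d).1 ⟨hd, fun e he hde => by
        have h1 := ht.2.2 d hd e he hde
        have h2 := ht.le e
        omega⟩
      refine ⟨⟨⟨i, hi⟩, Function.update t (c i) 0, ht.update_zero hd htd⟩, Subtype.ext ?_⟩
      simp only [F, Function.update_idem]
      rw [← htd, Function.update_eq_self]
  have hfin := fun i : R => finite_labellings (A \ {c i}) N
  unfold numLabellings
  rw [← Nat.card_congr (Equiv.ofBijective F hF), Nat.card_sigma, ← sum_coe_sort R]

theorem numLabellings_empty : numLabellings ∅ 0 = 1 := by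
  have hI : Set.Icc 1 0 = (∅ : Set ℕ) := by simp
  have h : IsLabelling ∅ 0 fun _ => 0 :=
    ⟨fun _ _ => rfl, by rw [hI]; exact Set.bijOn_empty _, fun _ h => h.elim⟩
  refine Nat.card_eq_one_iff_exists.2 ⟨⟨_, h⟩, fun t => Subtype.ext (funext fun c => ?_)⟩
  exact t.2.1 c (Set.notMem_empty c)

theorem card_shiftedStandardTableau {m k : ℕ} (mu : m.Partition) (lam : k.Partition) :
    Nat.card (ShiftedStandardTableau mu lam) =
      numLabellings (skewShiftedDiagram mu lam) (k - m) := by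
  classical
  set A := skewShiftedDiagram mu lam with hA
  let f : (A ≃ Set.Icc 1 (k - m)) → ℕ × ℕ → ℕ := fun T c => if h : c ∈ A then T ⟨c, h⟩ else 0
  have hf : ∀ T (c : A), f T c = T c := fun T c => dif_pos c.2
  have hlab : ∀ T : ShiftedStandardTableau mu lam, IsLabelling A (k - m) (f T.1) := by
    rintro ⟨T, hrow, hcol⟩
    refine ⟨fun c hc => dif_neg hc, ⟨fun c hc => ?_, fun c hc d hd h => ?_, fun b hb => ?_⟩, ?_⟩
    · rw [hf T ⟨c, hc⟩]
      exact (T ⟨c, hc⟩).2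
    · rw [hf T ⟨c, hc⟩, hf T ⟨d, hd⟩] at h
      exact congrArg Subtype.val (T.injective (Subtype.ext h))
    · refine ⟨T.symm ⟨b, hb⟩, (T.symm ⟨b, hb⟩).2, ?_⟩
      rw [hf]
      simp
    · intro c hc d hd hcd
      rw [hf T ⟨c, hc⟩, hf T ⟨d, hd⟩]
      rcases hcd with h | h
      · exact hrow ⟨c, hc⟩ ⟨d, hd⟩ h.1 h.2
      · exact hcol ⟨c, hc⟩ ⟨d, hd⟩ h.1 h.2
  refine Nat.card_congr (Equiv.ofBijective
    (fun T => (⟨f T.1, hlab T⟩ : {t // IsLabelling A (k - m) t})) ⟨fun T S h => ?_, fun t => ?_⟩)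
  · refine Subtype.ext (Equiv.ext fun c => Subtype.ext ?_)
    rw [← hf, ← hf]
    exact congrFun (congrArg Subtype.val h) c
  · refine ⟨⟨Set.BijOn.equiv t.1 t.2.2.1, fun c d h1 h2 => ?_, fun c d h1 h2 => ?_⟩, Subtype.ext ?_⟩
    · exact t.2.2.2 c c.2 d d.2 (Or.inl ⟨h1, h2⟩)
    · exact t.2.2.2 c c.2 d d.2 (Or.inr ⟨h1, h2⟩)
    · funext c
      by_cases hc : c ∈ A
      · exact hf _ ⟨c, hc⟩
      · rw [t.2.1 c hc]
        exact dif_neg hc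

/-! ### Shifted diagrams and their removable corners. -/

/-- A finite sequence followed by zeros. -/
def extendZero {n : ℕ} (x : Fin n → ℕ) (i : ℕ) : ℕ := if h : i < n then x ⟨i, h⟩ else 0

theorem extendZero_val {n : ℕ} (x : Fin n → ℕ) (i : Fin n) : extendZero x i = x i := dif_pos i.2

theorem extendZero_eq_getD {n : ℕ} (x : Fin n → ℕ) (i : ℕ) :
    extendZero x i = (List.ofFn x).getD i 0 := by
  unfold extendZero
  split_ifs with h
  · rw [List.getD_eq_getElem _ _ (by simpa using h), List.getElem_ofFn]
  · rw [List.getD_eq_default _ _ (by simpa using h)]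

theorem extendZero_castSucc {n : ℕ} (x : Fin (n + 1) → ℕ) (h : x (Fin.last n) = 0) :
    extendZero x = extendZero (x ∘ Fin.castSucc) := by
  funext i
  unfold extendZero
  rcases lt_trichotomy i n with hi | rfl | hi
  · rw [dif_pos (by omega), dif_pos hi]
    rfl
  · rw [dif_pos (by omega), dif_neg (lt_irrefl i)]
    exact h
  · rw [dif_neg (by omega), dif_neg (by omega)]

theorem extendZero_lower {n : ℕ} (x : Fin n → ℕ) (i : Fin n) (j : ℕ) :
    extendZero (lower x i) j = if j = i then x i - 1 else extendZero x j := by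
  unfold extendZero lower
  by_cases h : j < n
  · rw [dif_pos h, dif_pos h, Function.update_apply]
    simp [Fin.ext_iff]
  · rw [dif_neg h, dif_neg h, if_neg]
    rintro rfl
    exact h i.2

/-- The shifted diagram with row lengths `f`. -/
def diagramOf (f : ℕ → ℕ) : Set (ℕ × ℕ) := {c | c.1 ≤ c.2 ∧ c.2 < c.1 + f c.1}

open Classical in
/-- The number of standard labellings of the skew shifted diagram with row lengths `a` and `b`,
and `0` if the diagrams are not nested. -/
noncomputable def skewNum (a b : ℕ → ℕ) (N : ℕ) : ℕ :=
  if ∀ i, a i ≤ b i then numLabellings (diagramOf b \ diagramOf a) N else 0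

theorem skewDim_eq_skewNum {m k : ℕ} (mu : m.Partition) (lam : k.Partition) :
    skewDim mu lam = skewNum (part mu) (part lam) (k - m) := by
  unfold skewDim skewNum
  rw [card_shiftedStandardTableau]
  rfl

/-- `x i + i` is the column just past the end of shifted row `i`, so row ends move weakly to the
left going down. -/
theorem strictAnti_add_le {n : ℕ} {x : Fin n → ℕ} (hx : StrictAnti x) {i j : Fin n} (h : i ≤ j) :
    x j + j ≤ x i + i := by
  obtain ⟨d, hd⟩ := Nat.exists_eq_add_of_le (Fin.le_def.1 h)
  induction d generalizing j with
  | zero =>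
    have : j = i := Fin.ext hd
    rw [this]
  | succ d ih =>
    have hlt : (i : ℕ) + d < n := by omega
    have h1 := ih (j := ⟨i + d, hlt⟩) (Fin.le_def.2 (by simp)) rfl
    have h2 := hx (show (⟨i + d, hlt⟩ : Fin n) < j from Fin.lt_def.2 (by simp only; omega))
    simp only at h1
    omega

theorem lower_strictAnti_or {n : ℕ} {x : Fin n → ℕ} (hx : StrictAnti x) (hpos : ∀ i, 0 < x i)
    (i : Fin n) : StrictAnti (lower x i) ∨ ∃ j : Fin n, (j : ℕ) = i + 1 ∧ x i = x j + 1 := by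
  by_cases h : ∃ j : Fin n, (j : ℕ) = i + 1 ∧ x i = x j + 1
  · exact Or.inr h
  refine Or.inl fun p q hpq => ?_
  have hpq' := hx hpq
  unfold lower
  simp only [Function.update_apply]
  split_ifs with h1 h2 h2
  · exact absurd (h1.trans h2.symm) hpq.ne'
  · subst h1
    have := hpos q
    omega
  · subst h2
    have h3 := strictAnti_add_le hx hpq.le
    by_contra hle
    exact h ⟨q, by omega, by omega⟩
  · exact hpq'

theorem diagramOf_lower_sdiff {n : ℕ} (x : Fin n → ℕ) (hpos : ∀ i, 0 < x i) (a : ℕ → ℕ)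
    (i : Fin n) :
    diagramOf (extendZero (lower x i)) \ diagramOf a =
      (diagramOf (extendZero x) \ diagramOf a) \ {((i : ℕ), (i : ℕ) + x i - 1)} := by
  ext ⟨r, s⟩
  have hi := hpos i
  have hv := extendZero_val x i
  simp only [diagramOf, extendZero_lower, Set.mem_sdiff, Set.mem_ofPred_eq, Set.mem_singleton_iff,
    Prod.mk.injEq]
  split_ifs with h
  · subst h
    rw [hv]
    constructor
    · rintro ⟨h1, h2⟩
      exact ⟨⟨⟨h1.1, by omega⟩, h2⟩, by omega⟩
    · rintro ⟨⟨h1, h2⟩, h3⟩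
      exact ⟨⟨h1.1, by omega⟩, h2⟩
  · simp [h]

/-- A maximal cell ends its row. It is blocked from below exactly when the next row is one shorter,
since that row then ends in the same column; this is when lowering breaks strictness. Strictness of
`a` keeps the blocking cell outside the inner diagram. -/
theorem maximal_cell_iff {n : ℕ} {x : Fin n → ℕ} (hx : StrictAnti x) (hpos : ∀ i, 0 < x i)
    {a : ℕ → ℕ} (ha : ∀ i, 0 < a (i + 1) → a (i + 1) < a i) (d : ℕ × ℕ) :
    (d ∈ diagramOf (extendZero x) \ diagramOf a ∧
        ∀ e ∈ diagramOf (extendZero x) \ diagramOf a, ¬ cellLT d e) ↔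
      ∃ i : Fin n, (StrictAnti (lower x i) ∧ a i < x i) ∧ ((i : ℕ), (i : ℕ) + x i - 1) = d := by
  constructor
  · rintro ⟨⟨⟨h1, h2⟩, h3⟩, hmax⟩
    obtain ⟨r, s⟩ := d
    simp only [diagramOf, Set.mem_ofPred_eq, not_and, not_lt] at h1 h2 h3
    have h3' := h3 h1
    have hr : r < n := by
      by_contra hr
      rw [extendZero, dif_neg hr] at h2
      omega
    obtain ⟨i, rfl⟩ : ∃ i : Fin n, (i : ℕ) = r := ⟨⟨r, hr⟩, rfl⟩
    rw [extendZero_val] at h2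
    have hs : s = i + x i - 1 := by
      by_contra hne
      refine hmax (i, s + 1) ⟨⟨?_, ?_⟩, ?_⟩ (Or.inl ⟨rfl, Nat.lt_succ_self s⟩)
      · exact Nat.le_succ_of_le h1
      · simp only [extendZero_val]
        omega
      · simp only [diagramOf, Set.mem_ofPred_eq, not_and, not_lt]
        omega
    subst hs
    refine ⟨i, ⟨(lower_strictAnti_or hx hpos i).resolve_right ?_, by omega⟩, rfl⟩
    rintro ⟨j, hj, hij⟩
    have hjpos := hpos j
    refine hmax (j, i + x i - 1) ⟨⟨?_, ?_⟩, ?_⟩ (Or.inr ⟨rfl, ?_⟩)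
    · simp only
      omega
    · simp only [extendZero_val]
      omega
    · simp only [diagramOf, Set.mem_ofPred_eq, not_and, not_lt]
      intro _
      have := ha i
      rw [← hj] at this
      rcases Nat.eq_zero_or_pos (a j) with h0 | h0
      · omega
      · have := this h0
        omega
    · simp only
      omega
  · rintro ⟨i, ⟨hi, hai⟩, rfl⟩
    have hip := hpos i
    refine ⟨⟨⟨?_, ?_⟩, ?_⟩, ?_⟩
    · simp only
      omega
    · simp only [extendZero_val]
      omega
    · simp only [diagramOf, Set.mem_ofPred_eq, not_and, not_lt]
      omega
    · rintro ⟨q, s⟩ ⟨⟨h1, h2⟩, -⟩ (⟨rfl, h⟩ | ⟨rfl, h⟩)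
      · simp only [extendZero_val] at h2 h
        omega
      · simp only at h1 h2 h
        have hq : q < n := by
          by_contra hq
          rw [extendZero, dif_neg hq] at h2
          omega
        obtain ⟨j, rfl⟩ : ∃ j : Fin n, (j : ℕ) = q := ⟨⟨q, hq⟩, rfl⟩
        rw [extendZero_val] at h2
        have hij : i ≠ j := by
          rintro rfl
          omega
        have h3 := strictAnti_add_le hi (Fin.le_def.2 h.le)
        have h4 : lower x i i = x i - 1 := Function.update_self _ _ _
        have h5 : lower x i j = x j := Function.update_of_ne hij.symm _ _
        omega

open Classical in
theorem skewNum_succ {n : ℕ} {x : Fin n → ℕ} (hx : StrictAnti x) (hpos : ∀ i, 0 < x i)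
    {a : ℕ → ℕ} (ha : ∀ i, 0 < a (i + 1) → a (i + 1) < a i) (N : ℕ) :
    skewNum a (extendZero x) (N + 1) =
      ∑ i with StrictAnti (lower x i), skewNum a (extendZero (lower x i)) N := by
  have hle : ∀ i : Fin n, (∀ j, a j ≤ extendZero (lower x i) j) ↔
      (∀ j, a j ≤ extendZero x j) ∧ a i < x i := by
    intro i
    have hi := hpos i
    have hv := extendZero_val x i
    simp only [extendZero_lower]
    constructor
    · intro h
      have h0 := h i
      rw [if_pos rfl] at h0
      refine ⟨fun j => ?_, by omega⟩
      rcases eq_or_ne j i with rfl | hj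
      · omega
      · have := h j
        rwa [if_neg hj] at this
    · rintro ⟨h, h0⟩ j
      split_ifs with hj
      · subst hj
        omega
      · exact h j
  unfold skewNum
  by_cases h : ∀ i, a i ≤ extendZero x i
  · rw [if_pos h, numLabellings_succ
      (univ.filter fun i : Fin n => StrictAnti (lower x i) ∧ a i < x i)
      (fun i : Fin n => ((i : ℕ), (i : ℕ) + x i - 1))
      (fun i j e => Fin.ext (congrArg Prod.fst e))
      (fun d => (maximal_cell_iff hx hpos ha d).trans (by simp)),
      ← filter_filter, sum_filter (fun i : Fin n => a i < x i)]
    refine sum_congr rfl fun i _ => ?_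
    simp only [hle, diagramOf_lower_sdiff x hpos, h, implies_true, true_and]
  · rw [if_neg h]
    refine (sum_eq_zero fun i _ => if_neg ?_).symm
    rw [hle]
    exact fun e => h e.1

/-! ### Matching the two recursions and passing to partitions. -/

theorem sum_le_sum_of_getD_le : ∀ a b : List ℕ, (∀ i, a.getD i 0 ≤ b.getD i 0) → a.sum ≤ b.sum
  | [], _, _ => Nat.zero_le _
  | h :: t, [], hab => by
    have h1 := sum_le_sum_of_getD_le t [] fun i => by simpa using hab (i + 1)
    have h2 := hab 0
    simp at h1 h2 ⊢
    exact ⟨h2, h1⟩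
  | h :: t, h' :: t', hab => by
    have h1 := sum_le_sum_of_getD_le t t' fun i => by simpa using hab (i + 1)
    have h2 : h ≤ h' := by simpa using hab 0
    simp only [List.sum_cons]
    omega

theorem eq_of_getD_le_of_sum_eq : ∀ a b : List ℕ, (∀ m ∈ a, 0 < m) → (∀ m ∈ b, 0 < m) →
    (∀ i, a.getD i 0 ≤ b.getD i 0) → a.sum = b.sum → a = b
  | [], [], _, _, _, _ => rfl
  | [], h :: t, _, hb, _, hs => by
    have := hb h (by simp)
    simp only [List.sum_nil, List.sum_cons] at hs
    omega
  | h :: t, [], ha, _, hab, _ => by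
    have := ha h (by simp)
    have := hab 0
    simp at this
    omega
  | h :: t, h' :: t', ha, hb, hab, hs => by
    have htt : ∀ i, t.getD i 0 ≤ t'.getD i 0 := fun i => by simpa using hab (i + 1)
    have h1 := sum_le_sum_of_getD_le t t' htt
    have h2 : h ≤ h' := by simpa using hab 0
    simp only [List.sum_cons] at hs
    rw [eq_of_getD_le_of_sum_eq t t' (fun m hm => ha m (by simp [hm]))
      (fun m hm => hb m (by simp [hm])) htt (by omega), show h = h' by omega]

theorem skewNum_eq_factorial_mul_skewW (mu : List ℕ) (hmu : mu.Pairwise (· > ·))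
    (hmupos : ∀ m ∈ mu, 0 < m) (N : ℕ) :
    ∀ {n : ℕ} (x : Fin n → ℕ), StrictAnti x → ∑ i, x i = mu.sum + N →
      (skewNum (fun i => mu.getD i 0) (extendZero x) N : ℚ) = N.factorial * skewW mu n x := by
  classical
  have ha : ∀ i, 0 < mu.getD (i + 1) 0 → mu.getD (i + 1) 0 < mu.getD i 0 := by
    intro i hi
    have hlt : i + 1 < mu.length := by
      by_contra h
      rw [List.getD_eq_default _ _ (by omega)] at hi
      omega
    rw [List.getD_eq_getElem _ _ hlt, List.getD_eq_getElem _ _ (by omega)]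
    exact List.pairwise_iff_getElem.1 hmu _ _ _ _ (Nat.lt_succ_self i)
  -- Lowering a part `1` yields a zero, whereas the recursions need positive entries. A strictly
  -- decreasing sequence has at most one zero, in last place, and dropping it changes neither side.
  have reduce : ∀ N : ℕ, (∀ {n : ℕ} (x : Fin n → ℕ), StrictAnti x → (∀ i, 0 < x i) →
      ∑ i, x i = mu.sum + N →
      (skewNum (fun i => mu.getD i 0) (extendZero x) N : ℚ) = N.factorial * skewW mu n x) →
      ∀ {n : ℕ} (x : Fin n → ℕ), StrictAnti x → ∑ i, x i = mu.sum + N →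
      (skewNum (fun i => mu.getD i 0) (extendZero x) N : ℚ) = N.factorial * skewW mu n x := by
    intro N H n x hx hs
    cases n with
    | zero => exact H x hx (fun i => i.elim0) hs
    | succ n =>
      have hpos : ∀ i : Fin n, 0 < x i.castSucc := fun i =>
        (Nat.zero_le _).trans_lt (hx (Fin.castSucc_lt_last i))
      rcases Nat.eq_zero_or_pos (x (Fin.last n)) with h0 | h0
      · have he := extendZero_castSucc x h0
        rw [he, skewW_last mu x hmupos h0 hpos]
        refine H _ (hx.comp_strictMono Fin.strictMono_castSucc) hpos ?_
        rw [← hs, Fin.sum_univ_castSucc, h0]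
        rfl
      · exact H x hx (fun i => Fin.lastCases h0 hpos i) hs
  induction N with
  | zero =>
    intro n y hy hsy
    refine reduce _ (fun x hx hpos hs => ?_) y hy hsy
    rw [skewW_of_sum_le mu x hmu hx hpos (by omega), Nat.factorial_zero, Nat.cast_one, one_mul]
    unfold skewNum
    split_ifs with h1 h2 h2
    · have : (fun i => mu.getD i 0) = extendZero x := by
        funext i
        rw [extendZero_eq_getD, h2]
      rw [this, Set.sdiff_self, numLabellings_empty, Nat.cast_one]
    · refine absurd (eq_of_getD_le_of_sum_eq mu (List.ofFn x) hmupos ?_ ?_ ?_).symm h2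
      · intro m hm
        obtain ⟨i, rfl⟩ := List.mem_ofFn.1 hm
        exact hpos i
      · intro i
        rw [← extendZero_eq_getD]
        exact h1 i
      · rw [List.sum_ofFn, hs, add_zero]
    · refine absurd (fun i => ?_) h1
      rw [extendZero_eq_getD, h2]
    · simp
  | succ N ih =>
    intro l y hy hsy
    refine reduce _ (fun {n} x hx hpos hs => ?_) y hy hsy
    rw [skewNum_succ hx hpos ha]
    have hsum := sum_skewW_lower mu x hpos hx.injective
    have hs' : (∑ i, (x i : ℚ)) - mu.sum = N + 1 := by
      rw [← Nat.cast_sum, hs]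
      push_cast
      ring
    -- The algebraic recursion runs over all `i`, the combinatorial one only over strict lowerings.
    -- A non-strict lowering makes entries `i` and `i + 1` equal, so its `skewW` vanishes.
    rw [hs', ← sum_filter_add_sum_filter_not univ fun i => StrictAnti (lower x i)] at hsum
    rw [sum_eq_zero (s := univ.filter fun i => ¬ StrictAnti (lower x i)), add_zero] at hsum
    · rw [Nat.factorial_succ, Nat.cast_mul, mul_right_comm, Nat.cast_succ, ← hsum, sum_mul,
        Nat.cast_sum]
      refine sum_congr rfl fun i hi => ?_
      rw [ih (lower x i) (mem_filter.1 hi).2, mul_comm]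
      have hi := hpos i
      have h1 := sum_update_of_mem (mem_univ i) x (x i - 1)
      have h2 := sum_eq_add_sum_sdiff_singleton_of_mem (mem_univ i) x
      unfold lower
      omega
    · intro i hi
      obtain ⟨j, hj, hij⟩ :=
        (lower_strictAnti_or hx hpos i).resolve_left (mem_filter.1 hi).2
      refine skewW_eq_zero mu _ hj ?_
      have hne : j ≠ i := by
        rintro rfl
        omega
      unfold lower
      rw [Function.update_self, Function.update_of_ne hne]
      omega

theorem partList_pairwise {k : ℕ} (lam : k.Partition) (h : lam.parts.Nodup) :
    (partList lam).Pairwise (· > ·) := by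
  have h1 : (partList lam).Pairwise (· ≥ ·) := Multiset.pairwise_sort ..
  have h2 : (partList lam).Nodup := by
    rw [← Multiset.coe_nodup, partList, Multiset.sort_eq]
    exact h
  exact h1.imp₂ (fun a b hab hne => lt_of_le_of_ne hab (Ne.symm hne)) h2

theorem partList_pos {k : ℕ} (lam : k.Partition) (m : ℕ) (hm : m ∈ partList lam) : 0 < m :=
  lam.parts_pos ((Multiset.mem_sort _).1 hm)

theorem partList_sum {k : ℕ} (lam : k.Partition) : (partList lam).sum = k := by
  rw [← Multiset.sum_coe, partList, Multiset.sort_eq, lam.parts_sum]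

theorem ofFn_part {k : ℕ} (lam : k.Partition) :
    List.ofFn (fun i : Fin (length lam) => part lam i) = partList lam := by
  refine List.ext_getElem (by simp [length_partList]) fun i h1 h2 => ?_
  rw [List.getElem_ofFn]
  exact List.getD_eq_getElem _ _ h2

theorem part_strictAnti {k : ℕ} (lam : k.Partition) (h : lam.parts.Nodup) :
    StrictAnti fun i : Fin (length lam) => part lam i := by
  intro i j hij
  have hi : (i : ℕ) < (partList lam).length := by rw [length_partList]; exact i.2
  have hj : (j : ℕ) < (partList lam).length := by rw [length_partList]; exact j.2
  have e1 : part lam i = (partList lam)[(i : ℕ)] := List.getD_eq_getElem _ _ hi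
  have e2 : part lam j = (partList lam)[(j : ℕ)] := List.getD_eq_getElem _ _ hj
  simp only [e1, e2]
  exact List.pairwise_iff_getElem.1 (partList_pairwise lam h) _ _ _ _ hij

theorem skewDim_eq_factorial_mul_skewW {m k : ℕ} (mu : m.Partition) (lam : k.Partition)
    (hmu : mu.parts.Nodup) (hlam : lam.parts.Nodup) (hmk : m ≤ k) :
    (skewDim mu lam : ℚ) = (k - m).factorial *
      skewW (partList mu) (length lam) (fun i => part lam i) := by
  rw [skewDim_eq_skewNum, ← skewNum_eq_factorial_mul_skewW (partList mu)
    (partList_pairwise mu hmu) (partList_pos mu) (k - m) _ (part_strictAnti lam hlam)]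
  · have : extendZero (fun i : Fin (length lam) => part lam i) = part lam := by
      funext i
      rw [extendZero_eq_getD, ofFn_part]
      rfl
    rw [this]
    rfl
  · rw [← List.sum_ofFn, ofFn_part, partList_sum, partList_sum]
    omega

theorem dim_eq_factorial_mul_schurH {k : ℕ} (lam : k.Partition) (hlam : lam.parts.Nodup) :
    (dim lam : ℚ) = k.factorial * schurH (fun i : Fin (length lam) => part lam i) := by
  have h0 : (default : Nat.Partition 0).parts = 0 := by
    have := (default : Nat.Partition 0).parts_sum
    refine Multiset.eq_zero_of_forall_notMem fun a ha => ?_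
    have h1 := (default : Nat.Partition 0).parts_pos ha
    have h2 := Multiset.single_le_sum (fun x _ => Nat.zero_le x) a ha
    omega
  have h1 : partList (default : Nat.Partition 0) = [] := by
    rw [partList, h0, Multiset.sort_zero]
  rw [dim, skewDim_eq_factorial_mul_skewW _ _ (by rw [h0]; exact Multiset.nodup_zero) hlam
    (Nat.zero_le k), h1]
  rfl

end ShiftedDim

theorem theorem1p6 (m k : ℕ) (mu : m.Partition) (lam : k.Partition)
    (hmu : mu.parts.Nodup) (hlam : lam.parts.Nodup) (hmk : m ≤ k) :
    (ShiftedDim.skewDim mu lam : ℚ) =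
      (ShiftedDim.dim lam : ℚ) *
        (ShiftedDim.factorialPAt mu lam / ShiftedDim.decFactorial (k : ℚ) m) := by
  rw [ShiftedDim.skewDim_eq_factorial_mul_skewW mu lam hmu hlam hmk,
    ShiftedDim.dim_eq_factorial_mul_schurH lam hlam,
    ShiftedDim.skewW_partList mu lam (ShiftedDim.part_strictAnti lam hlam).injective,
    ShiftedDim.decFactorial, descPochhammer_eval_eq_descFactorial,
    -- Writing `k!` as `(k - m)!` times the decreasing factorial cancels the denominator.
    ← Nat.factorial_mul_descFactorial hmk]
  have h : k.descFactorial m ≠ 0 := by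
    rw [Ne, Nat.descFactorial_eq_zero_iff_lt]
    omega
  push_cast
  field_simp
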